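/- Let $R$ be a normal domain, meaning here a Noetherian integral domain that is integrally closed in its field of fractions, and let $\operatorname{Cl}(R)$ denote its divisor class group: the free abelian group on the height one prime ideals of $R$, modulo the subgroup of principal divisors $\operatorname{div}(a/b)=\operatorname{div}(a)-\operatorname{div}(b)$ with $a,b\in R\setminus\{0\}$, where $\operatorname{div}(a)=\sum_{\operatorname{ht}\mathfrak p=1}\operatorname{length}_{R_{\mathfrak p}}(R_{\mathfrak p}/aR_{\mathfrak p})\,[\mathfrak p]$. **Lemma.** Let $R\subseteq S$ be an extension of normal domains such that $S$ is a finitely generated $R$-module. If $\operatorname{Cl}(S)$ is a torsion group, then $\operatorname{Cl}(R)$ is a torsion group. -/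

import Mathlib

/-- The height one prime ideals of a commutative ring `R`. -/
abbrev HeightOnePrime (R : Type*) [CommRing R] : Type _ :=
  {p : PrimeSpectrum R // p.asIdeal.height = 1}

/-- The group of Weil divisors: the free abelian group on the height one primes. -/
abbrev WeilDivisor (R : Type*) [CommRing R] : Type _ :=
  HeightOnePrime R →₀ ℤ

namespace HeightOnePrime

variable {R : Type*} [CommRing R]

/-- The order of `a` along `p`: the length of `R_p / a R_p` over the local ring `R_p`. For a
normal Noetherian domain, `R_p` is a discrete valuation ring, and this is its normalized
valuation. The length is finite for `a ≠ 0` (see `ord_ne_top`). -/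
noncomputable def ord (p : HeightOnePrime R) (a : R) : ℕ :=
  (Ring.ord (Localization.AtPrime p.1.asIdeal)
    (algebraMap R (Localization.AtPrime p.1.asIdeal) a)).toNat

theorem ord_eq_zero_of_notMem (p : HeightOnePrime R) {a : R} (ha : a ∉ p.1.asIdeal) :
    p.ord a = 0 := by
  rw [ord, Ring.ord_of_isUnit (IsLocalization.map_units (M := p.1.asIdeal.primeCompl) _ ⟨a, ha⟩)]
  rfl

variable [IsDomain R]

theorem algebraMap_mem_nonZeroDivisors (p : HeightOnePrime R) {a : R} (ha : a ≠ 0) :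
    algebraMap R (Localization.AtPrime p.1.asIdeal) a ∈
      nonZeroDivisors (Localization.AtPrime p.1.asIdeal) :=
  IsLocalization.map_nonZeroDivisors_le p.1.asIdeal.primeCompl _
    (Submonoid.mem_map_of_mem _ (mem_nonZeroDivisors_of_ne_zero ha))

theorem ord_ne_top [IsNoetherianRing R] (p : HeightOnePrime R) {a : R} (ha : a ≠ 0) :
    Ring.ord (Localization.AtPrime p.1.asIdeal)
      (algebraMap R (Localization.AtPrime p.1.asIdeal) a) ≠ ⊤ := by
  have hdim : Ring.KrullDimLE 1 (Localization.AtPrime p.1.asIdeal) := by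
    rw [Ring.krullDimLE_iff,
      IsLocalization.AtPrime.ringKrullDim_eq_height p.1.asIdeal, p.2]
    rfl
  have hnoeth : IsNoetherianRing (Localization.AtPrime p.1.asIdeal) :=
    IsLocalization.isNoetherianRing p.1.asIdeal.primeCompl _ inferInstance
  exact Ring.ord_ne_top (p.algebraMap_mem_nonZeroDivisors ha)

theorem ord_mul [IsNoetherianRing R] (p : HeightOnePrime R) {a b : R} (ha : a ≠ 0)
    (hb : b ≠ 0) : p.ord (a * b) = p.ord a + p.ord b := by
  rw [ord, map_mul, Ring.ord_mul _ (p.algebraMap_mem_nonZeroDivisors hb),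
    ENat.toNat_add (p.ord_ne_top ha) (p.ord_ne_top hb)]
  rfl

/-- A nonzero element of a Noetherian domain lies in only finitely many height one primes. -/
theorem finite_mem [IsNoetherianRing R] {a : R} (ha : a ≠ 0) :
    {p : HeightOnePrime R | a ∈ p.1.asIdeal}.Finite := by
  refine Set.Finite.of_finite_image
    (f := fun p : HeightOnePrime R => p.1.asIdeal)
    ((Ideal.finite_minimalPrimes_of_isNoetherianRing R (Ideal.span {a})).subset ?_) ?_
  · rintro _ ⟨p, hp, rfl⟩
    refine ⟨⟨p.1.isPrime, (Ideal.span_singleton_le_iff_mem _).2 hp⟩, ?_⟩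
    rintro q ⟨hq, hqa⟩ hqp
    by_contra hlt
    have hlt' : q < p.1.asIdeal := lt_of_le_not_ge hqp hlt
    have h0 : (⊥ : Ideal R) < q := by
      refine bot_lt_iff_ne_bot.2 fun h => ha ?_
      simpa [h] using hqa
    have h1 : q.height < 1 := by
      have := Ideal.height_strict_mono_of_isPrime hlt'
      rwa [p.2] at this
    exact h0.ne' (Ideal.height_eq_zero_iff_eq_bot.1 (Order.lt_one_iff.1 h1))
  · intro p _ q _ h
    exact Subtype.ext (PrimeSpectrum.ext h)

end HeightOnePrime

namespace WeilDivisor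

variable {R : Type*} [CommRing R] [IsDomain R] [IsNoetherianRing R]

/-- The divisor `div(a) = ∑ ord_p(a) p` of a nonzero element `a`. -/
noncomputable def div (a : R) (ha : a ≠ 0) : WeilDivisor R :=
  Finsupp.ofSupportFinite (fun p => (p.ord a : ℤ)) <|
    (HeightOnePrime.finite_mem ha).subset fun p hp => by
      by_contra h
      exact hp (by simp [p.ord_eq_zero_of_notMem h])

@[simp]
theorem div_apply (a : R) (ha : a ≠ 0) (p : HeightOnePrime R) : div a ha p = p.ord a := rfl

theorem div_mul (a b : R) (ha : a ≠ 0) (hb : b ≠ 0) :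
    div (a * b) (mul_ne_zero ha hb) = div a ha + div b hb := by
  ext p
  simp [p.ord_mul ha hb]

variable (R) in
/-- The group of principal divisors `div(a / b) = div(a) - div(b)`, where `a / b` runs through
the nonzero elements of the fraction field. -/
def principal : AddSubgroup (WeilDivisor R) where
  carrier := {D | ∃ (a b : R) (ha : a ≠ 0) (hb : b ≠ 0), D = div a ha - div b hb}
  zero_mem' := ⟨1, 1, one_ne_zero, one_ne_zero, by simp⟩
  add_mem' := by
    rintro _ _ ⟨a, b, ha, hb, rfl⟩ ⟨c, d, hc, hd, rfl⟩
    refine ⟨a * c, b * d, mul_ne_zero ha hc, mul_ne_zero hb hd, ?_⟩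
    rw [div_mul a c ha hc, div_mul b d hb hd]
    abel
  neg_mem' := by
    rintro _ ⟨a, b, ha, hb, rfl⟩
    exact ⟨b, a, hb, ha, by abel⟩

end WeilDivisor

/-- The divisor class group `Cl(R)` of a (normal) Noetherian domain: Weil divisors modulo
principal divisors. -/
abbrev DivisorClassGroup (R : Type*) [CommRing R] [IsDomain R] [IsNoetherianRing R] : Type _ :=
  WeilDivisor R ⧸ WeilDivisor.principal R

/-! It suffices to find, for each height one prime `p` of `R`, a nonzero `f` lying in `p` and in no
other height one prime: then `div f` is a positive multiple of `p`. The primes of `S` over `p` are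
finitely many, all of height one. As Cl(S) is torsion, a positive multiple of their sum is
principal; being effective, it is the divisor of some `s` in `S`, by normality
(`dvd_of_forall_ord_le`). Take `f` to be the norm of `s`, which lies in `R` because `R` is normal: a
prime of `R` contains it exactly when some prime above contains `s`. -/

namespace HeightOnePrime

variable {R : Type*} [CommRing R] [IsDomain R] [IsNoetherianRing R]

theorem ord_pos_of_mem (p : HeightOnePrime R) {a : R} (ha : a ≠ 0) (hap : a ∈ p.1.asIdeal) :
    0 < p.ord a := by
  rw [ord, Nat.pos_iff_ne_zero, Ne, ENat.toNat_eq_zero, not_or]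
  refine ⟨fun h => ?_, p.ord_ne_top ha⟩
  rw [Ring.ord, Module.length_eq_zero_iff, Ideal.Quotient.subsingleton_iff,
    Ideal.span_singleton_eq_top, IsLocalization.AtPrime.isUnit_to_map_iff _ p.1.asIdeal] at h
  exact h hap

theorem ord_pos_iff (p : HeightOnePrime R) {a : R} (ha : a ≠ 0) :
    0 < p.ord a ↔ a ∈ p.1.asIdeal :=
  ⟨fun h => by_contra fun hn => h.ne' (p.ord_eq_zero_of_notMem hn), p.ord_pos_of_mem ha⟩

end HeightOnePrime

/-- In a normal Noetherian domain, let `p` be an ideal containing `b ≠ 0` with `d * p ⊆ (b)`.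
If `b` does not divide `d`, then some `d * m` with `m ∈ p` is `b` times an element outside `p`. -/
theorem exists_mem_mul_eq_mul_notMem {S : Type*} [CommRing S] [IsDomain S] [IsNoetherianRing S]
    [IsIntegrallyClosed S] {p : Ideal S} {b d : S} (hb : b ≠ 0) (hbp : b ∈ p) (hbd : ¬ b ∣ d)
    (hp : ∀ x ∈ p, b ∣ d * x) : ∃ m ∈ p, ∃ u ∉ p, d * m = b * u := by
  by_contra! h
  let K := FractionRing S
  have hbK : algebraMap S K b ≠ 0 := by simpa using hb
  let M := Submodule.map (Algebra.linearMap S K) p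
  -- By `h`, multiplication by `d / b` maps the nonzero finitely generated module `p` into itself.
  have hint : IsIntegral S (algebraMap S K d / algebraMap S K b) := by
    refine isIntegral_of_smul_mem_submodule M ?_ ?_ _ ?_
    · rw [Submodule.ne_bot_iff]
      exact ⟨_, ⟨b, hbp, rfl⟩, hbK⟩
    · exact Submodule.FG.map _ (IsNoetherian.noetherian _)
    · rintro _ ⟨x, hx, rfl⟩
      obtain ⟨u, hu⟩ := hp x hx
      refine ⟨u, by_contra fun hn => h x hx u hn hu, ?_⟩
      simp only [Algebra.linearMap_apply, smul_eq_mul]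
      rw [div_mul_eq_mul_div, eq_div_iff hbK, ← map_mul, ← map_mul, hu, mul_comm]
  obtain ⟨y, hy⟩ := IsIntegrallyClosed.algebraMap_eq_of_integral hint
  refine hbd ⟨y, IsFractionRing.injective S K ?_⟩
  rw [map_mul, hy, mul_div_cancel₀ _ hbK]

/-- A normal Noetherian domain is the intersection of its localizations at height one primes:
divisibility can be tested on the orders along these primes. -/
theorem dvd_of_forall_ord_le {S : Type*} [CommRing S] [IsDomain S] [IsNoetherianRing S]
    [IsIntegrallyClosed S] {a b : S} (ha : a ≠ 0) (hb : b ≠ 0)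
    (h : ∀ p : HeightOnePrime S, p.ord b ≤ p.ord a) : b ∣ a := by
  by_contra hba
  let N := Submodule.span S {(Ideal.Quotient.mk (Ideal.span {b}) a)}
  let y : N := ⟨Ideal.Quotient.mk _ a, Submodule.mem_span_singleton_self _⟩
  have hy : y ≠ 0 := fun h0 => hba <| by
    rw [← Ideal.mem_span_singleton, ← Ideal.Quotient.eq_zero_iff_mem]
    exact congrArg Subtype.val h0
  -- Working in the submodule generated by the class of `a` makes `p` the annihilator of a multiple
  -- `c * a` modulo `b`.
  obtain ⟨p, hp, -⟩ := exists_le_isAssociatedPrime_of_isNoetherianRing S y hy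
  obtain ⟨hprime, ⟨z, hz⟩, hpz⟩ := isAssociatedPrime_iff.1 hp
  obtain ⟨c, rfl⟩ := Submodule.mem_span_singleton.1 hz
  have hmem (x : S) : x ∈ p ↔ b ∣ c * a * x := by
    rw [hpz, Submodule.mem_colon_singleton, Submodule.mem_bot, ← Ideal.mem_span_singleton,
      ← Ideal.Quotient.eq_zero_iff_mem, Subtype.ext_iff]
    simp only [SetLike.mk_smul_mk, ZeroMemClass.coe_zero, Algebra.smul_def, map_mul,
      Ideal.Quotient.algebraMap_eq]
    rw [mul_comm]
  have hbp : b ∈ p := (hmem b).2 (dvd_mul_left _ _)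
  have hbd : ¬ b ∣ c * a := fun hd =>
    hprime.ne_top ((Ideal.eq_top_iff_one p).2 ((hmem 1).2 (by simpa using hd)))
  obtain ⟨m, hm, u, hu, hmu⟩ :=
    exists_mem_mul_eq_mul_notMem hb hbp hbd fun x hx => (hmem x).1 hx
  have hc : c ≠ 0 := by
    rintro rfl
    simp at hbd
  have hu0 : u ≠ 0 := fun h0 => hu (h0 ▸ p.zero_mem)
  have hm0 : m ≠ 0 := by
    rintro rfl
    exact (mul_ne_zero hb hu0) (by simpa using hmu.symm)
  -- Every `x ∈ p` satisfies `x * u ∈ (m)` with `u ∉ p`, so no smaller prime contains `m`; Krull's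
  -- principal ideal theorem then bounds the height.
  have hmin : p ∈ (Ideal.span {m}).minimalPrimes := by
    refine ⟨⟨hprime, (Ideal.span_singleton_le_iff_mem _).2 hm⟩, ?_⟩
    rintro q ⟨hq, hmq⟩ hqp x hx
    obtain ⟨v, hv⟩ := (hmem x).1 hx
    have hxu : x * u = v * m := mul_left_cancel₀ hb <| by
      linear_combination m * hv - x * hmu
    refine (hq.mem_or_mem (x := x) (y := u) ?_).resolve_right fun h => hu (hqp h)
    rw [hxu]
    exact q.mul_mem_left _ ((Ideal.span_singleton_le_iff_mem _).1 hmq)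
  have hht : p.height = 1 := by
    refine le_antisymm (Ideal.height_le_one_of_isPrincipal_of_mem_minimalPrimes _ p hmin) ?_
    rw [Order.one_le_iff_ne_zero, Ne, Ideal.height_eq_zero_iff_eq_bot]
    rintro rfl
    exact hb hbp
  let P : HeightOnePrime S := ⟨⟨p, hprime⟩, hht⟩
  -- Since `ord m > 0 = ord u`, this forces `ord a < ord b`.
  have h1 : P.ord c + P.ord a + P.ord m = P.ord b + P.ord u := by
    rw [← P.ord_mul hc ha, ← P.ord_mul (mul_ne_zero hc ha) hm0, hmu, P.ord_mul hb hu0]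
  have h2 : 0 < P.ord m := P.ord_pos_of_mem hm0 hm
  have h3 : P.ord u = 0 := P.ord_eq_zero_of_notMem hu
  have h4 := h P
  omega

section IntegralExtension

variable {R S : Type*} [CommRing R] [IsDomain R] [CommRing S] [IsDomain S] [Algebra R S]

/-- A prime lying over a height one prime in an integral extension of domains has height one. -/
theorem height_eq_one_of_comap_eq [IsNoetherianRing R] [Algebra.IsIntegral R S]
    (hRS : Function.Injective (algebraMap R S)) (p : HeightOnePrime R) {Q : Ideal S} [Q.IsPrime]
    (hQ : Q.comap (algebraMap R S) = p.1.asIdeal) : Q.height = 1 := by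
  have hp0 : p.1.asIdeal ≠ ⊥ := fun h => by
    have := p.2
    simp [h] at this
  refine le_antisymm ?_ ?_
  · rw [← Nat.cast_one, Ideal.height_le_iff]
    intro q hq hqQ
    have hlt : q.comap (algebraMap R S) < p.1.asIdeal := hQ ▸ Ideal.IsIntegral.comap_lt_comap hqQ
    have h1 := Ideal.height_strict_mono_of_isPrime hlt
    rw [p.2, Order.lt_one_iff, Ideal.height_eq_zero_iff_eq_bot] at h1
    rw [Ideal.eq_bot_of_comap_eq_bot h1]
    simp
  · rw [Order.one_le_iff_ne_zero, Ne, Ideal.height_eq_zero_iff_eq_bot]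
    rintro rfl
    exact hp0 (hQ ▸ Ideal.comap_bot_of_injective _ hRS)

attribute [local instance] FractionRing.liftAlgebra

/-- If the norm of `s` lies in a prime `P`, then `s` lies in a prime lying over `P`. -/
theorem exists_comap_eq_of_intNorm_mem [IsIntegrallyClosed R] [IsIntegrallyClosed S]
    [Module.Finite R S] [Module.IsTorsionFree R S] {s : S} {P : Ideal R} [P.IsPrime]
    (h : Algebra.intNorm R S s ∈ P) :
    ∃ Q : Ideal S, Q.IsPrime ∧ Q.comap (algebraMap R S) = P ∧ s ∈ Q := by
  -- Going up needs `(s) ∩ R ⊆ P`: if `r = s * t`, the norm of `r` is a power of `r` and a multiple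
  -- of the norm of `s`.
  obtain ⟨Q, hsQ, hQ, hQP⟩ := Ideal.exists_ideal_over_prime_of_isIntegral P (Ideal.span {s}) <| by
    intro r hr
    obtain ⟨t, ht⟩ := Ideal.mem_span_singleton.1 (Ideal.mem_comap.1 hr)
    have hr' : Algebra.intNorm R S (algebraMap R S r) ∈ P := by
      rw [ht, map_mul]
      exact P.mul_mem_right _ h
    rw [show Algebra.intNorm R S (algebraMap R S r) =
      r ^ Module.finrank (FractionRing R) (FractionRing S) from ?_] at hr'
    · exact Ideal.IsPrime.mem_of_pow_mem ‹_› _ hr'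
    · apply IsFractionRing.injective R (FractionRing R)
      rw [Algebra.algebraMap_intNorm_fractionRing, ← IsScalarTower.algebraMap_apply,
        IsScalarTower.algebraMap_apply R (FractionRing R), Algebra.norm_algebraMap, map_pow]
  exact ⟨Q, hQ, hQP, (Ideal.span_singleton_le_iff_mem _).1 hsQ⟩

end IntegralExtension

/-- If every height one prime of `R` is set-theoretically cut out, among height one primes, by a
nonzero element, then the divisor class group is torsion. -/
theorem DivisorClassGroup.isAddTorsion_of_forall_exists {R : Type*} [CommRing R] [IsDomain R]
    [IsNoetherianRing R]
    (h : ∀ p : HeightOnePrime R, ∃ f : R, f ≠ 0 ∧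
      ∀ q : HeightOnePrime R, f ∈ q.1.asIdeal ↔ q = p) :
    IsAddTorsion (DivisorClassGroup R) := by
  have hsingle (p : HeightOnePrime R) :
      IsOfFinAddOrder (QuotientAddGroup.mk (Finsupp.single p 1) : DivisorClassGroup R) := by
    obtain ⟨f, hf, hfp⟩ := h p
    refine isOfFinAddOrder_iff_nsmul_eq_zero.2
      ⟨p.ord f, (p.ord_pos_iff hf).2 ((hfp p).2 rfl), ?_⟩
    rw [← QuotientAddGroup.mk_nsmul, QuotientAddGroup.eq_zero_iff]
    refine ⟨f, 1, hf, one_ne_zero, ?_⟩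
    ext q
    have h1 : q.ord (1 : R) = 0 :=
      q.ord_eq_zero_of_notMem ((Ideal.ne_top_iff_one _).1 q.1.isPrime.ne_top)
    by_cases hq : q = p
    · subst hq
      simp [h1]
    · have h2 : q.ord f = 0 := q.ord_eq_zero_of_notMem fun hm => hq ((hfp q).1 hm)
      simp [h1, h2, Ne.symm hq]
  intro D
  induction D using QuotientAddGroup.induction_on with
  | H D =>
    induction D using Finsupp.induction_linear with
    | zero => exact IsOfFinAddOrder.zero
    | add D E hD hE => exact hD.add hE
    | single p n =>
      have := (hsingle p).zsmul (i := n)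
      rwa [← QuotientAddGroup.mk_zsmul, Finsupp.smul_single, smul_eq_mul, mul_one] at this

/-- If the divisor class group of a normal Noetherian domain is torsion, then every finite set of
height one primes is the set of those containing some nonzero element. -/
theorem DivisorClassGroup.exists_mem_iff_of_isAddTorsion {S : Type*} [CommRing S] [IsDomain S]
    [IsNoetherianRing S] [IsIntegrallyClosed S] (hS : IsAddTorsion (DivisorClassGroup S))
    (T : Finset (HeightOnePrime S)) :
    ∃ s : S, s ≠ 0 ∧ ∀ q : HeightOnePrime S, s ∈ q.1.asIdeal ↔ q ∈ T := by
  classical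
  let D : WeilDivisor S := ∑ q ∈ T, Finsupp.single q 1
  have hD (q : HeightOnePrime S) : D q = if q ∈ T then 1 else 0 := by
    simp [D, Finsupp.finsetSum_apply, Finsupp.single_apply]
  obtain ⟨n, hn, hnD⟩ := isOfFinAddOrder_iff_nsmul_eq_zero.1 (hS (QuotientAddGroup.mk D))
  rw [← QuotientAddGroup.mk_nsmul, QuotientAddGroup.eq_zero_iff] at hnD
  obtain ⟨a, b, ha, hb, hab⟩ := hnD
  have hord (q : HeightOnePrime S) :
      (n : ℤ) * (if q ∈ T then 1 else 0) = q.ord a - q.ord b := by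
    have := DFunLike.congr_fun hab q
    simpa [hD] using this
  -- The divisor `n • D` is effective.
  obtain ⟨s, rfl⟩ := dvd_of_forall_ord_le ha hb fun q => by
    have := hord q
    split_ifs at this <;> omega
  have hs : s ≠ 0 := right_ne_zero_of_mul ha
  refine ⟨s, hs, fun q => ?_⟩
  have := hord q
  rw [q.ord_mul hb hs] at this
  rw [← q.ord_pos_iff hs]
  split_ifs at this with hq <;> simp only [hq, iff_true, iff_false] <;> omega

attribute [local instance] FractionRing.liftAlgebra in
theorem mainTheorem12 {R : Type*} {S : Type*}
    [CommRing R] [IsDomain R] [IsNoetherianRing R] [IsIntegrallyClosed R]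
    [CommRing S] [IsDomain S] [IsNoetherianRing S] [IsIntegrallyClosed S]
    [Algebra R S] [Module.Finite R S] (hRS : Function.Injective (algebraMap R S))
    (hS : IsAddTorsion (DivisorClassGroup S)) :
    IsAddTorsion (DivisorClassGroup R) := by
  have hfaithful : FaithfulSMul R S := (faithfulSMul_iff_algebraMap_injective R S).2 hRS
  have htf : Module.IsTorsionFree R S := inferInstance
  refine DivisorClassGroup.isAddTorsion_of_forall_exists fun p => ?_
  have hfin : {q : HeightOnePrime S |
      q.1.asIdeal.comap (algebraMap R S) = p.1.asIdeal}.Finite := by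
    obtain ⟨a, hap, ha⟩ := Submodule.exists_mem_ne_zero_of_ne_bot
      (show p.1.asIdeal ≠ ⊥ from fun h => by
        have := p.2
        simp [h] at this)
    refine (HeightOnePrime.finite_mem ((map_ne_zero_iff _ hRS).2 ha)).subset fun q hq => ?_
    exact Ideal.mem_comap.1 (Eq.symm hq ▸ hap)
  obtain ⟨s, hs, hsq⟩ := DivisorClassGroup.exists_mem_iff_of_isAddTorsion hS hfin.toFinset
  simp only [Set.Finite.mem_toFinset, Set.mem_ofPred_eq] at hsq
  have hdvd := Algebra.dvd_algebraMap_intNorm_self (A := R) (B := S) s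
  have : FiniteDimensional (FractionRing R) (FractionRing S) :=
    .of_isLocalization R S (nonZeroDivisors R)
  refine ⟨Algebra.intNorm R S s, Algebra.intNorm_ne_zero.2 hs, fun P => ⟨fun hP => ?_, ?_⟩⟩
  · obtain ⟨Q, hQ, hQP, hsQ⟩ := exists_comap_eq_of_intNorm_mem hP
    have := (hsq ⟨⟨Q, hQ⟩, height_eq_one_of_comap_eq hRS P hQP⟩).1 hsQ
    exact Subtype.ext (PrimeSpectrum.ext (hQP.symm.trans this))
  -- Some prime over `p` exists; it contains `s`, hence also the norm, which `s` divides.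
  · rintro rfl
    obtain ⟨Q, -, hQ, hQP⟩ := Ideal.exists_ideal_over_prime_of_isIntegral P.1.asIdeal (⊥ : Ideal S)
      (by simp [Ideal.comap_bot_of_injective _ hRS])
    have hsQ := (hsq ⟨⟨Q, hQ⟩, height_eq_one_of_comap_eq hRS P hQP⟩).2 hQP
    rw [← hQP, Ideal.mem_comap]
    exact Q.mem_of_dvd hdvd hsQ
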